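/- Let $X$ be a compact metrizable space equipped with a dynamical system of one of two kinds. (a) A continuous action $\phi:\Gamma\times X\to X$ of a topological group or semigroup $\Gamma$ with identity (so $\phi_1=\mathrm{id}_X$ and $\phi_{\gamma'}\circ\phi_\gamma=\phi_{\gamma'\gamma}$); here a Borel probability measure $\mu$ on $X$ is called invariant if $\mu(\phi_\gamma^{-1}A)=\mu(A)$ for all $\gamma\in\Gamma$ and all Borel sets $A\subseteq X$. (For instance, a continuous map $T:X\to X$ gives an action of $\Gamma=\mathbb{N}_0$.) (b) An upper semi-continuous set-valued map $T:X\to 2^X$ with closed (possibly empty) values; here a Borel probability measure $\mu$ is called invariant if $\mu(A)\le\mu(T^{-1}A)$ for all Borel sets $A\subseteq X$, where $T^{-1}A=\{x\in X: T(x)\cap A\neq\emptyset\}$ (this set is universally measurable). Let $\mathcal{M}$ be the set of invariant Borel probability measures, and assume $\mathcal{M}\neq\emptyset$. For $f\in C(X)$, the space of continuous real-valued functions on $X$ with the supremum norm, a measure $\mu\in\mathcal{M}$ is called $f$-maximizing if $\int f\,d\mu=\sup\{\int f\,d\nu:\nu\in\mathcal{M}\}$. Let $V$ be a separable real Fréchet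 space densely and continuously embedded in $C(X)$, i.e. equipped with a continuous injective linear map $V\to C(X)$ with dense range, by which elements of $V$ are regarded as functions on $X$. Then $$V^{!}=\{f\in V: f\text{ has a unique maximizing measure}\}$$ is a prevalent subset of $V$. That is, $V\setminus V^{!}$ is shy (Haar null): there are a Borel set $B\supseteq V\setminus V^{!}$ and a Borel measure $m$ on $V$ such that $0<m(K)<\infty$ for some compact $K\subseteq V$, and $m(v+B)=0$ for every $v\in V$. -/

import Mathlib

open MeasureTheory Topology TopologicalSpace Set
open scoped Pointwise ENNReal

universe u v

namespace ErgodicOptimization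

/-- A topological dynamical system on `X`: either a continuous action of a topological
(semi)group with identity, or an upper semi-continuous set-valued map `X → 2^X` with closed
(possibly empty) values. A continuous self-map of `X` is an action of the discrete
semigroup `ℕ`; a topological group acts through its underlying topological semigroup. -/
inductive DynSystem (X : Type u) [TopologicalSpace X] : Type (max u (v + 1))
  | action (G : Type v) [Monoid G] [TopologicalSpace G] [ContinuousMul G]
      [MulAction G X] [ContinuousSMul G X] : DynSystem X
  | setValued (T : X → Closeds X) (hT : UpperHemicontinuous fun x => (T x : Set X)) :
      DynSystem X

/-- The set of invariant Borel probability measures of a system. For an action this means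
`μ (φ_γ⁻¹ A) = μ A`; for a set-valued map it means `μ A ≤ μ (T⁻¹ A)`, where
`T⁻¹ A = {x | T x ∩ A ≠ ∅}`. The latter set is analytic, hence universally measurable, and
`μ` of it is computed by the outer measure, that is, by the completion of `μ`. -/
def DynSystem.invariantMeasures {X : Type u} [TopologicalSpace X] [MeasurableSpace X] :
    DynSystem.{u, v} X → Set (ProbabilityMeasure X)
  | @DynSystem.action _ _ G _ _ _ _ _ =>
      {μ | ∀ (γ : G) (A : Set X), MeasurableSet A →
        (μ : Measure X) ((fun x => γ • x) ⁻¹' A) = (μ : Measure X) A}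
  | .setValued T _ =>
      {μ | ∀ A : Set X, MeasurableSet A →
        (μ : Measure X) A ≤ (μ : Measure X) {x | ((T x : Set X) ∩ A).Nonempty}}

/-- `μ` is an `f`-maximizing measure: it is invariant and
`∫ f dμ = sup {∫ f dν : ν invariant}`. -/
def DynSystem.IsMaximizing {X : Type u} [TopologicalSpace X] [MeasurableSpace X]
    (D : DynSystem.{u, v} X) (f : C(X, ℝ)) (μ : ProbabilityMeasure X) : Prop :=
  μ ∈ D.invariantMeasures ∧
    ∫ x, f x ∂(μ : Measure X) =
      sSup ((fun ν : ProbabilityMeasure X => ∫ x, f x ∂(ν : Measure X)) '' D.invariantMeasures)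

/-- A Borel measure `m` on `V` is transverse to a set `S`: some compact set has positive finite
measure, and every translate of `S` is null. -/
def IsTransverse {V : Type*} [AddCommGroup V] [TopologicalSpace V] [MeasurableSpace V]
    (m : Measure V) (S : Set V) : Prop :=
  (∃ K : Set V, IsCompact K ∧ 0 < m K ∧ m K < ∞) ∧ ∀ v : V, m (v +ᵥ S) = 0

/-- Shy (Haar null) sets: subsets of Borel sets that admit a transverse measure. -/
def IsShy {V : Type*} [AddCommGroup V] [TopologicalSpace V] [MeasurableSpace V] [BorelSpace V]
    (S : Set V) : Prop :=
  ∃ B : Set V, S ⊆ B ∧ MeasurableSet B ∧ ∃ m : Measure V, IsTransverse m B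

/-- Prevalent sets: complements of shy sets. -/
def IsPrevalent {V : Type*} [AddCommGroup V] [TopologicalSpace V] [MeasurableSpace V]
    [BorelSpace V] (S : Set V) : Prop :=
  IsShy Sᶜ

end ErgodicOptimization

/-!
Let `M` be the set of invariant measures and `β f = max {∫ f dν : ν ∈ M}` (`maxIntegral M`).
The set `M` is weakly compact (`DynSystem.isCompact_invariantMeasures`), so every `f` has a
maximizing measure. For a set-valued map this rests on upper semi-continuity: the inequality
`μ A ≤ μ (T⁻¹ A)` need only be tested on closed `A`, for which `T⁻¹ A` is closed, and there it
survives weak limits by the portmanteau theorem.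

The maximizing measures of `f` are subgradients of `β` at `f`. If `f` has two of them, they give
different integrals to some member `wₙ` of a countable dense subset of `V`, and then `β` is not
differentiable at `f` in the direction `wₙ`, that is, `f` lies in `kinkSet M wₙ`
(`mem_kinkSet_of_integral_lt`). This set is Borel, and since `β` is Lipschitz, it meets every line
in the direction `wₙ` in a Lebesgue null set (`volume_line_inter_kinkSet`).

It remains to find one measure transverse to a countable union of sets `Bₙ`, where `Bₙ` is null on
the lines in the direction `wₙ` (`exists_isTransverse_iUnion`). For small scalars `cₙ > 0` the
random series `∑ tₙ cₙ wₙ`, with `tₙ` independent and uniform in `[0, 1]`, converges and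
depends continuously on `(tₙ) ∈ [0, 1]^ℕ`, so its law is carried by a compact set; applying
Fubini's theorem to the coordinate `tₙ` shows that this law vanishes on every translate of `Bₙ`.
-/

open Filter
open scoped unitInterval

namespace ErgodicOptimization

/-! ### Product measures and null sets along coordinates -/

/-- Replacing one coordinate of a product measure by an independent copy does not change it. -/
lemma infinitePi_map_update {κ : Type*} [DecidableEq κ] {Ω : κ → Type*}
    [∀ i, MeasurableSpace (Ω i)] (μ : ∀ i, Measure (Ω i)) [∀ i, IsProbabilityMeasure (μ i)]
    (i : κ) :
    ((Measure.infinitePi μ).prod (μ i)).map (fun p => Function.update p.1 i p.2) =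
      Measure.infinitePi μ := by
  have hmeas : Measurable fun p : (∀ i, Ω i) × Ω i => Function.update p.1 i p.2 :=
    measurable_update'
  refine Measure.eq_infinitePi _ fun s t ht => ?_
  have hpre : (fun p : (∀ i, Ω i) × Ω i => Function.update p.1 i p.2) ⁻¹' Set.pi s t =
      Set.pi (s.erase i : Finset κ) t ×ˢ (if i ∈ s then t i else univ) := by
    ext ⟨x, y⟩
    simp only [mem_preimage, Set.mem_pi, Finset.mem_coe, mem_prod, Finset.mem_erase]
    constructor
    · intro h
      refine ⟨fun j hj => by simpa [hj.1] using h j hj.2, ?_⟩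
      split_ifs with hi
      · simpa using h i hi
      · trivial
    · rintro ⟨h1, h2⟩ j hj
      rcases eq_or_ne j i with rfl | hne
      · simpa [hj] using h2
      · simpa [hne] using h1 j ⟨hne, hj⟩
  rw [Measure.map_apply hmeas (.pi s.countable_toSet fun j _ => ht j), hpre, Measure.prod_prod,
    Measure.infinitePi_pi _ fun j _ => ht j]
  split_ifs with hi
  · rw [Finset.prod_erase_mul _ _ hi]
  · rw [measure_univ, mul_one, Finset.erase_eq_of_notMem hi]

lemma infinitePi_null_of_forall_update_null {κ : Type*} [DecidableEq κ] {Ω : κ → Type*}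
    [∀ i, MeasurableSpace (Ω i)] (μ : ∀ i, Measure (Ω i)) [∀ i, IsProbabilityMeasure (μ i)]
    (i : κ) {E : Set (∀ i, Ω i)} (hE : MeasurableSet E)
    (h : ∀ x, μ i {y | Function.update x i y ∈ E} = 0) : Measure.infinitePi μ E = 0 := by
  have hmeas : Measurable fun p : (∀ i, Ω i) × Ω i => Function.update p.1 i p.2 :=
    measurable_update'
  rw [← infinitePi_map_update μ i, Measure.map_apply hmeas hE, Measure.measure_prod_null (hmeas hE)]
  exact Eventually.of_forall h

/-! ### A measure that charges no set null along countably many directions -/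

section Series

variable {V : Type*} [AddCommGroup V] [Module ℝ V] [UniformSpace V] [IsUniformAddGroup V]
  [ContinuousSMul ℝ V] [MetrizableSpace V] [CompleteSpace V]

/-- Any sequence in a complete metrizable topological vector space can be rescaled so that all
its combinations with coefficients in `[0, 1]` converge, to a limit depending continuously on the
coefficients. -/
lemma exists_scaling_continuous_series (w : ℕ → V) :
    ∃ c : ℕ → ℝ, (∀ n, 0 < c n) ∧ ∃ Φ : (ℕ → I) → V, Continuous Φ ∧
      ∀ t, Tendsto (fun N => ∑ k ∈ Finset.range N, ((t k : ℝ) * c k) • w k) atTop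
        (𝓝 (Φ t)) := by
  obtain ⟨u, hu, hadd⟩ := IsTopologicalAddGroup.exists_antitone_basis_nhds_zero V
  have hc : ∀ n, ∃ c : ℝ, 0 < c ∧ ∀ s : I, ((s : ℝ) * c) • w n ∈ u (n + 1) := by
    intro n
    have hcont : Tendsto (fun r : ℝ => r • w n) (𝓝 0) (𝓝 0) := by
      have : Continuous fun r : ℝ => r • w n := by fun_prop
      simpa using this.tendsto 0
    obtain ⟨ε, hε, h⟩ := Metric.mem_nhds_iff.1 (hcont (hu.mem (n + 1)))
    refine ⟨ε / 2, by positivity, fun s => h ?_⟩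
    have h0 := s.2.1
    have h1 := s.2.2
    rw [mem_ball_zero_iff, Real.norm_eq_abs, abs_of_nonneg (by positivity)]
    nlinarith
  choose c hc0 hc using hc
  set S : ℕ → (ℕ → I) → V := fun N t => ∑ k ∈ Finset.range N, ((t k : ℝ) * c k) • w k with hS
  have htail : ∀ t m n, n ≤ m → S m t - S n t ∈ u n := by
    intro t m n hnm
    refine Nat.decreasingInduction' (P := fun k => S m t - S k t ∈ u k)
      (fun k _ _ hk => hadd k ⟨_, hc k (t k), _, hk, ?_⟩) hnm ?_
    · simp only [hS, Finset.sum_range_succ]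
      abel
    · simpa using mem_of_mem_nhds (hu.mem m)
  have hcauchy : UniformCauchySeqOn S atTop univ := by
    intro d hd
    obtain ⟨e, he, hsymm, hed⟩ := comp_symm_of_uniformity hd
    rw [uniformity_eq_comap_nhds_zero] at he
    obtain ⟨W, hW, hWe⟩ := he
    obtain ⟨n, hn⟩ := hu.mem_iff.1 hW
    have key : ∀ m ≥ n, ∀ t, (S n t, S m t) ∈ e := fun m hm t => hWe (hn (htail t m n hm))
    filter_upwards [(eventually_ge_atTop n).prod_mk (eventually_ge_atTop n)] with p hp t _
    exact hed ⟨S n t, hsymm (key _ hp.1 t), key _ hp.2 t⟩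
  choose Φ hΦ using fun t => cauchySeq_tendsto_of_complete (hcauchy.cauchySeq (mem_univ t))
  refine ⟨c, hc0, Φ, ?_, hΦ⟩
  refine (tendstoUniformlyOn_univ.1
    (hcauchy.tendstoUniformlyOn_of_tendsto fun t _ => hΦ t)).continuous
    (Frequently.of_forall fun N => ?_)
  simp only [hS]
  fun_prop

/-- For any sequence of directions there is a measure, carried by a compact set, that vanishes on
every Borel set which meets the lines in at least one of these directions in Lebesgue null sets.
It is the law of `∑ tₙ cₙ wₙ`, with `tₙ` independent and uniform in `[0, 1]`. -/
lemma exists_measure_null_of_null_on_lines [MeasurableSpace V] [BorelSpace V] (w : ℕ → V) :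
    ∃ m : Measure V, (∃ K : Set V, IsCompact K ∧ 0 < m K ∧ m K < ∞) ∧
      ∀ (n : ℕ) (B : Set V), MeasurableSet B →
        (∀ v, volume {s : ℝ | v + s • w n ∈ B} = 0) → m B = 0 := by
  obtain ⟨c, hc, Φ, hΦ, hlim⟩ := exists_scaling_continuous_series w
  set P : Measure (ℕ → I) := Measure.infinitePi fun _ => volume
  refine ⟨P.map Φ, ⟨range Φ, isCompact_range hΦ, ?_⟩, fun n B hB hnull => ?_⟩
  · rw [Measure.map_apply hΦ.measurable (isCompact_range hΦ).measurableSet]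
    simp
  have hupdate : ∀ t (y : I), Φ (Function.update t n y) =
      (Φ t - ((t n : ℝ) * c n) • w n) + ((y : ℝ) * c n) • w n := by
    intro t y
    refine tendsto_nhds_unique (hlim _) ?_
    refine (((hlim t).sub_const (((t n : ℝ) * c n) • w n)).add_const
      (((y : ℝ) * c n) • w n)).congr' ?_
    filter_upwards [eventually_gt_atTop n] with N hN
    have hn := Finset.mem_range.2 hN
    rw [← Finset.add_sum_erase _ _ hn, ← Finset.add_sum_erase _ _ hn, Function.update_self,
      Finset.sum_congr rfl fun k hk => by
        rw [← Function.update_of_ne (Finset.ne_of_mem_erase hk) y t]]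
    abel
  rw [Measure.map_apply hΦ.measurable hB]
  refine infinitePi_null_of_forall_update_null _ n (hΦ.measurable hB) fun t => ?_
  simp only [mem_preimage, hupdate]
  have hscaled : volume
      {s : ℝ | (Φ t - ((t n : ℝ) * c n) • w n) + (s * c n) • w n ∈ B} = 0 := by
    have := Real.volume_preimage_mul_right (hc n).ne'
      {s : ℝ | (Φ t - ((t n : ℝ) * c n) • w n) + s • w n ∈ B}
    rwa [hnull, mul_zero] at this
  rw [unitInterval.volume_apply]
  refine measure_mono_null ?_ hscaled
  rintro _ ⟨y, hy, rfl⟩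
  exact hy

/-- A countable union of Borel sets, each meeting the lines in some direction in Lebesgue null
sets, has a transverse measure. -/
lemma exists_isTransverse_iUnion [MeasurableSpace V] [BorelSpace V] (w : ℕ → V) (B : ℕ → Set V)
    (hB : ∀ n, MeasurableSet (B n))
    (hnull : ∀ n v, volume {s : ℝ | v + s • w n ∈ B n} = 0) :
    ∃ m : Measure V, IsTransverse m (⋃ n, B n) := by
  obtain ⟨m, hK, hm⟩ := exists_measure_null_of_null_on_lines w
  refine ⟨m, hK, fun v => ?_⟩
  rw [vadd_set_iUnion, measure_iUnion_null_iff]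
  refine fun n => hm n _ ?_ fun x => ?_
  · rw [← preimage_vadd_neg]
    have : Continuous fun x : V => -v +ᵥ x := by
      simp only [vadd_eq_add]
      fun_prop
    exact this.measurable (hB n)
  · simpa only [mem_vadd_set_iff_neg_vadd_mem, vadd_eq_add, ← add_assoc] using hnull n (-v + x)

end Series

/-! ### The maximal integral over a compact set of measures -/

section MaxIntegral

variable {X : Type*} [TopologicalSpace X] [MeasurableSpace X]

/-- The supremum of `∫ f dν` over `ν ∈ M`. -/
noncomputable def maxIntegral (M : Set (ProbabilityMeasure X)) (f : C(X, ℝ)) : ℝ :=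
  sSup ((fun ν : ProbabilityMeasure X => ∫ x, f x ∂(ν : Measure X)) '' M)

/-- The functions at which `maxIntegral M` is not differentiable in the direction `v`. Since
`maxIntegral M` is convex, this says that its symmetric second difference in that direction,
divided by the step, stays away from zero along the steps `1 / (k + 1)`; in this form the set is a
countable union of closed sets. -/
def kinkSet (M : Set (ProbabilityMeasure X)) (v : C(X, ℝ)) : Set C(X, ℝ) :=
  {f | ∃ j : ℕ, ∀ k : ℕ, 1 / ((j : ℝ) + 1) ≤
    ((k : ℝ) + 1) * (maxIntegral M (f + (1 / ((k : ℝ) + 1)) • v) - maxIntegral M f +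
      (maxIntegral M (f + (-(1 / ((k : ℝ) + 1))) • v) - maxIntegral M f))}

variable [CompactSpace X] [BorelSpace X]

lemma integrable_continuousMap (f : C(X, ℝ)) (ν : ProbabilityMeasure X) :
    Integrable (fun x => f x) (ν : Measure X) :=
  (BoundedContinuousFunction.mkOfCompact f).integrable _

lemma continuous_integral_continuousMap (f : C(X, ℝ)) :
    Continuous fun ν : ProbabilityMeasure X => ∫ x, f x ∂(ν : Measure X) :=
  ProbabilityMeasure.continuous_integral_boundedContinuousFunction
    (BoundedContinuousFunction.mkOfCompact f)

lemma integral_le_integral_add_norm_sub (f g : C(X, ℝ)) (ν : ProbabilityMeasure X) :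
    ∫ x, f x ∂(ν : Measure X) ≤ ∫ x, g x ∂(ν : Measure X) + ‖f - g‖ := by
  have h : ∫ x, f x ∂(ν : Measure X) ≤ ∫ x, (g x + ‖f - g‖) ∂(ν : Measure X) := by
    refine integral_mono (integrable_continuousMap f ν)
      ((integrable_continuousMap g ν).add (integrable_const _)) fun x => ?_
    have := (le_abs_self _).trans ((f - g).norm_coe_le_norm x)
    simp only [ContinuousMap.sub_apply] at this
    simp only
    linarith
  rwa [integral_add (integrable_continuousMap g ν) (integrable_const _), integral_const,
    probReal_univ, one_smul] at h

lemma integral_add_smul (f v : C(X, ℝ)) (r : ℝ) (ν : ProbabilityMeasure X) :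
    ∫ x, (f + r • v) x ∂(ν : Measure X) =
      ∫ x, f x ∂(ν : Measure X) + r * ∫ x, v x ∂(ν : Measure X) := by
  simp only [ContinuousMap.add_apply, ContinuousMap.smul_apply, smul_eq_mul]
  rw [integral_add (integrable_continuousMap f ν) ((integrable_continuousMap v ν).const_mul r),
    integral_const_mul]

lemma integral_le_maxIntegral {M : Set (ProbabilityMeasure X)} {ν : ProbabilityMeasure X}
    (hν : ν ∈ M) (f : C(X, ℝ)) : ∫ x, f x ∂(ν : Measure X) ≤ maxIntegral M f := by
  refine le_csSup ⟨‖f‖, ?_⟩ (mem_image_of_mem _ hν)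
  rintro _ ⟨ν, -, rfl⟩
  simpa using integral_le_integral_add_norm_sub f 0 ν

lemma lipschitzWith_maxIntegral {M : Set (ProbabilityMeasure X)} (hM : M.Nonempty) :
    LipschitzWith 1 (maxIntegral M) := by
  refine LipschitzWith.of_le_add fun f g => csSup_le (hM.image _) ?_
  rintro _ ⟨ν, hν, rfl⟩
  rw [dist_eq_norm]
  have h1 := integral_le_integral_add_norm_sub f g ν
  have h2 := integral_le_maxIntegral hν g
  simp only
  linarith

lemma exists_integral_eq_maxIntegral {M : Set (ProbabilityMeasure X)} (hM : M.Nonempty)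
    (hcompact : IsCompact M) (f : C(X, ℝ)) :
    ∃ ν ∈ M, ∫ x, f x ∂(ν : Measure X) = maxIntegral M f := by
  obtain ⟨ν, hν, h⟩ :=
    hcompact.exists_sSup_image_eq hM (continuous_integral_continuousMap f).continuousOn
  exact ⟨ν, hν, h.symm⟩

/-- Two maximizing measures with different integrals of `v` are two different subgradients, so
`maxIntegral M` has a kink in the direction `v`. -/
lemma mem_kinkSet_of_integral_lt {M : Set (ProbabilityMeasure X)} {f v : C(X, ℝ)}
    {μ ν : ProbabilityMeasure X} (hμ : μ ∈ M) (hν : ν ∈ M)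
    (hfμ : ∫ x, f x ∂(μ : Measure X) = maxIntegral M f)
    (hfν : ∫ x, f x ∂(ν : Measure X) = maxIntegral M f)
    (hlt : ∫ x, v x ∂(μ : Measure X) < ∫ x, v x ∂(ν : Measure X)) : f ∈ kinkSet M v := by
  obtain ⟨j, hj⟩ := exists_nat_one_div_lt (sub_pos.2 hlt)
  refine ⟨j, fun k => hj.le.trans ?_⟩
  set h : ℝ := 1 / ((k : ℝ) + 1) with hh
  have hk : ((k : ℝ) + 1) * h = 1 := by rw [hh]; field_simp
  have h1 := integral_le_maxIntegral hν (f + h • v)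
  have h2 := integral_le_maxIntegral hμ (f + (-h) • v)
  rw [integral_add_smul] at h1 h2
  calc ∫ x, v x ∂(ν : Measure X) - ∫ x, v x ∂(μ : Measure X)
      = ((k : ℝ) + 1) * (h * ∫ x, v x ∂(ν : Measure X) + -h * ∫ x, v x ∂(μ : Measure X)) := by
        linear_combination
          (∫ x, v x ∂(μ : Measure X) - ∫ x, v x ∂(ν : Measure X)) * hk
    _ ≤ _ := by
        refine mul_le_mul_of_nonneg_left ?_ (by positivity)
        linarith

lemma measurableSet_preimage_kinkSet {M : Set (ProbabilityMeasure X)} (hM : M.Nonempty)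
    (v : C(X, ℝ)) {Y : Type*} [TopologicalSpace Y] [MeasurableSpace Y] [BorelSpace Y]
    {F : Y → C(X, ℝ)} (hF : Continuous F) : MeasurableSet (F ⁻¹' kinkSet M v) := by
  have hcont : Continuous (maxIntegral M) := (lipschitzWith_maxIntegral hM).continuous
  have heq : F ⁻¹' kinkSet M v = ⋃ j : ℕ, ⋂ k : ℕ, {y | 1 / ((j : ℝ) + 1) ≤
      ((k : ℝ) + 1) * (maxIntegral M (F y + (1 / ((k : ℝ) + 1)) • v) - maxIntegral M (F y) +
        (maxIntegral M (F y + (-(1 / ((k : ℝ) + 1))) • v) - maxIntegral M (F y)))} := by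
    ext y
    simp only [kinkSet, mem_preimage, mem_ofPred_eq, mem_iUnion, mem_iInter]
  rw [heq]
  refine .iUnion fun j => .iInter fun k => IsClosed.measurableSet ?_
  exact isClosed_le (by fun_prop) (by fun_prop)

/-- By Lebesgue's theorem the Lipschitz function `s ↦ maxIntegral M (f + s • v)` is
differentiable almost everywhere, and its second differences are `o(1 / k)` where it is. -/
lemma volume_line_inter_kinkSet {M : Set (ProbabilityMeasure X)} (hM : M.Nonempty)
    (f v : C(X, ℝ)) : volume {s : ℝ | f + s • v ∈ kinkSet M v} = 0 := by
  set g : ℝ → ℝ := fun s => maxIntegral M (f + s • v) with hg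
  have hline : LipschitzWith ‖v‖₊ fun s : ℝ => f + s • v := by
    refine LipschitzWith.of_dist_le_mul fun s t => ?_
    rw [dist_add_left, dist_eq_norm, ← sub_smul, norm_smul, mul_comm, dist_eq_norm, coe_nnnorm]
  have hlip := (lipschitzWith_maxIntegral hM).comp hline
  refine measure_mono_null ?_ (ae_iff.1 hlip.ae_differentiableAt_real)
  rintro s ⟨j, hj⟩ hdiff
  change DifferentiableAt ℝ g s at hdiff
  have hstep : Tendsto (fun k : ℕ => 1 / ((k : ℝ) + 1)) atTop (𝓝[≠] 0) :=
    tendsto_nhdsWithin_iff.2 ⟨tendsto_one_div_add_atTop_nhds_zero_nat,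
      Eventually.of_forall fun k => by simp; positivity⟩
  have hstep' : Tendsto (fun k : ℕ => -(1 / ((k : ℝ) + 1))) atTop (𝓝[≠] 0) :=
    tendsto_nhdsWithin_iff.2 ⟨by
      simpa only [neg_zero] using (tendsto_one_div_add_atTop_nhds_zero_nat (𝕜 := ℝ)).neg,
      Eventually.of_forall fun k => by simp; positivity⟩
  have h := (hdiff.hasDerivAt.tendsto_slope_zero.comp hstep).sub
    (hdiff.hasDerivAt.tendsto_slope_zero.comp hstep')
  rw [sub_self] at h
  refine absurd (ge_of_tendsto h (Eventually.of_forall fun k => ?_))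
    (not_le.2 (Nat.one_div_pos_of_nat (α := ℝ) (n := j)))
  refine (hj k).trans_eq ?_
  simp only [hg, Function.comp_apply, smul_eq_mul, one_div, inv_neg, inv_inv, add_smul, add_assoc]
  ring

end MaxIntegral

/-! ### Compactness of the set of invariant measures -/

section Invariant

lemma isClosed_setOf_inter_nonempty {X : Type*} [TopologicalSpace X] {T : X → Closeds X}
    (hT : UpperHemicontinuous fun x => (T x : Set X)) {A : Set X} (hA : IsClosed A) :
    IsClosed {x | ((T x : Set X) ∩ A).Nonempty} :=
  (hT.inter hA).isClosed_domain

variable {X : Type*} [TopologicalSpace X] [CompactSpace X] [MetrizableSpace X]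
  [MeasurableSpace X] [BorelSpace X]

/-- By inner regularity, the inequality defining invariant measures of a set-valued map need only
be tested on closed sets. -/
lemma measure_le_of_forall_isClosed {T : X → Closeds X} {μ : Measure X} [IsFiniteMeasure μ]
    (h : ∀ A, IsClosed A → μ A ≤ μ {x | ((T x : Set X) ∩ A).Nonempty}) {A : Set X}
    (hA : MeasurableSet A) : μ A ≤ μ {x | ((T x : Set X) ∩ A).Nonempty} := by
  rw [hA.measure_eq_iSup_isClosed_of_ne_top (measure_ne_top μ A)]
  exact iSup₂_le fun K hKA => iSup_le fun hK =>
    (h K hK).trans (measure_mono fun x hx => hx.mono (inter_subset_inter_right _ hKA))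

/-- A weak limit `μ` of measures satisfying `ν A ≤ ν (T⁻¹ A)` for closed `A` satisfies it too:
the portmanteau theorem gives `μ A ≤ μ (T⁻¹ A')` for closed neighbourhoods `A'` of `A`, and the
sets `T⁻¹ A'` decrease to `T⁻¹ A` because the values of `T` are compact. -/
lemma isClosed_setOf_measure_le_setValued {T : X → Closeds X}
    (hT : UpperHemicontinuous fun x => (T x : Set X)) :
    IsClosed {μ : ProbabilityMeasure X | ∀ A : Set X, MeasurableSet A →
      (μ : Measure X) A ≤ (μ : Measure X) {x | ((T x : Set X) ∩ A).Nonempty}} := by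
  let := metrizableSpaceMetric X
  refine isClosed_iff_forall_filter.2 fun μ F hF hFM hFμ A hA =>
    measure_le_of_forall_isClosed (fun A hA => ?_) hA
  have hlim : Tendsto (fun ν : ProbabilityMeasure X => ν) F (𝓝 μ) := hFμ
  let N : ℕ → Set X := fun k => Metric.cthickening (1 / ((k : ℝ) + 1)) A
  have hNclosed : ∀ k, IsClosed {x | ((T x : Set X) ∩ N k).Nonempty} := fun k =>
    isClosed_setOf_inter_nonempty hT Metric.isClosed_cthickening
  have hle : ∀ k, (μ : Measure X) A ≤ (μ : Measure X) {x | ((T x : Set X) ∩ N k).Nonempty} := by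
    intro k
    calc (μ : Measure X) A
        ≤ (μ : Measure X) (Metric.thickening (1 / ((k : ℝ) + 1)) A) :=
          measure_mono (Metric.self_subset_thickening (by positivity) A)
      _ ≤ F.liminf fun ν : ProbabilityMeasure X =>
            (ν : Measure X) (Metric.thickening (1 / ((k : ℝ) + 1)) A) :=
          ProbabilityMeasure.le_liminf_measure_open_of_tendsto hlim Metric.isOpen_thickening
      _ ≤ F.liminf fun ν : ProbabilityMeasure X =>
            (ν : Measure X) {x | ((T x : Set X) ∩ N k).Nonempty} := by
          refine liminf_le_liminf ?_
          filter_upwards [hFM (mem_principal_self _)] with ν hν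
          exact (measure_mono (Metric.thickening_subset_cthickening _ _)).trans
            (hν (N k) Metric.isClosed_cthickening.measurableSet)
      _ ≤ F.limsup fun ν : ProbabilityMeasure X =>
            (ν : Measure X) {x | ((T x : Set X) ∩ N k).Nonempty} := liminf_le_limsup
      _ ≤ (μ : Measure X) {x | ((T x : Set X) ∩ N k).Nonempty} :=
          ProbabilityMeasure.limsup_measure_closed_le_of_tendsto hlim (hNclosed k)
  have hinter : ⋂ k, {x | ((T x : Set X) ∩ N k).Nonempty} ⊆
      {x | ((T x : Set X) ∩ A).Nonempty} := by
    intro x hx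
    by_contra hempty
    obtain ⟨δ, hδ, hdisj⟩ := (disjoint_iff_inter_eq_empty.2
      (not_nonempty_iff_eq_empty.1 hempty)).exists_cthickenings (T x).isClosed.isCompact hA
    obtain ⟨k, hk⟩ := exists_nat_one_div_lt hδ
    obtain ⟨y, hyT, hyN⟩ := mem_iInter.1 hx k
    exact hdisj.le_bot
      ⟨Metric.self_subset_cthickening _ hyT, Metric.cthickening_mono hk.le A hyN⟩
  refine (ge_of_tendsto' (tendsto_measure_iInter_atTop
    (fun k => (hNclosed k).measurableSet.nullMeasurableSet) ?_
    ⟨0, measure_ne_top (μ : Measure X) _⟩) hle).trans (measure_mono hinter)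
  exact fun k l hkl x hx => hx.mono (inter_subset_inter_right _
    (Metric.cthickening_mono (Nat.one_div_le_one_div hkl) A))

lemma isClosed_setOf_measure_preimage_eq {X : Type*} [TopologicalSpace X] [MetrizableSpace X]
    [MeasurableSpace X] [BorelSpace X] {φ : X → X} (hφ : Continuous φ) :
    IsClosed {μ : ProbabilityMeasure X | ∀ A : Set X, MeasurableSet A →
      (μ : Measure X) (φ ⁻¹' A) = (μ : Measure X) A} := by
  have heq : {μ : ProbabilityMeasure X | ∀ A : Set X, MeasurableSet A →
      (μ : Measure X) (φ ⁻¹' A) = (μ : Measure X) A} =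
      {μ | μ.map hφ.measurable.aemeasurable = μ} := by
    ext μ
    have hmap : ((μ.map hφ.measurable.aemeasurable : ProbabilityMeasure X) : Measure X) =
        (μ : Measure X).map φ := ProbabilityMeasure.toMeasure_map _ _
    rw [mem_ofPred_eq, mem_ofPred_eq]
    constructor
    · intro h
      refine Subtype.ext (hmap.trans (Measure.ext fun A hA => ?_))
      rw [Measure.map_apply hφ.measurable hA]
      exact h A hA
    · intro h A hA
      rw [← Measure.map_apply hφ.measurable hA, ← hmap, h]
  rw [heq]
  exact isClosed_eq (ProbabilityMeasure.continuous_map hφ) continuous_id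

lemma DynSystem.isCompact_invariantMeasures (D : DynSystem X) :
    IsCompact D.invariantMeasures := by
  refine IsClosed.isCompact ?_
  cases D with
  | action G =>
    simp only [DynSystem.invariantMeasures, ofPred_forall]
    exact isClosed_iInter fun γ => by
      simpa only [ofPred_forall] using
        isClosed_setOf_measure_preimage_eq (X := X) (continuous_const_smul γ)
  | setValued T hT => exact isClosed_setOf_measure_le_setValued hT

/-- Integrals of a dense set of continuous functions separate probability measures. -/
lemma exists_integral_ne_of_ne {κ : Type*} {v : κ → C(X, ℝ)} (hv : DenseRange v)
    {μ ν : ProbabilityMeasure X} (hne : μ ≠ ν) :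
    ∃ i, ∫ x, v i x ∂(μ : Measure X) ≠ ∫ x, v i x ∂(ν : Measure X) := by
  by_contra! h
  have hcont (ρ : ProbabilityMeasure X) :
      Continuous fun f : C(X, ℝ) => ∫ x, f x ∂(ρ : Measure X) := by
    refine (LipschitzWith.of_le_add fun f g => ?_).continuous
    rw [dist_eq_norm]
    exact integral_le_integral_add_norm_sub f g ρ
  have heq := hv.equalizer (hcont μ) (hcont ν) (funext h)
  exact hne (Subtype.ext (ext_of_forall_integral_eq_of_IsFiniteMeasure
    (μ := (μ : Measure X)) (ν := (ν : Measure X)) fun f => congrFun heq f.toContinuousMap))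

end Invariant

end ErgodicOptimization

open ErgodicOptimization in
theorem theorem4
    {X : Type*} [TopologicalSpace X] [CompactSpace X] [MetrizableSpace X]
    [MeasurableSpace X] [BorelSpace X]
    (D : ErgodicOptimization.DynSystem X) (hD : D.invariantMeasures.Nonempty)
    {V : Type*} [AddCommGroup V] [Module ℝ V]
    [UniformSpace V] [IsUniformAddGroup V] [ContinuousSMul ℝ V] [LocallyConvexSpace ℝ V]
    [MetrizableSpace V] [CompleteSpace V] [SeparableSpace V]
    [MeasurableSpace V] [BorelSpace V]
    (ι : V →L[ℝ] C(X, ℝ)) (hinj : Function.Injective ι) (hdense : DenseRange ι) :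
    ErgodicOptimization.IsPrevalent
      {f : V | ∃! μ : ProbabilityMeasure X, D.IsMaximizing (ι f) μ} := by
  set M := D.invariantMeasures
  let w : ℕ → V := denseSeq V
  have hw : DenseRange fun n => ι (w n) := hdense.comp (denseRange_denseSeq V) ι.continuous
  refine ⟨⋃ n, ι ⁻¹' kinkSet M (ι (w n)), fun f hf => ?_, .iUnion fun n =>
    measurableSet_preimage_kinkSet hD _ ι.continuous, exists_isTransverse_iUnion w _
    (fun n => measurableSet_preimage_kinkSet hD _ ι.continuous) fun n v => ?_⟩
  · obtain ⟨μ, hμ, hfμ⟩ :=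
      exists_integral_eq_maxIntegral hD D.isCompact_invariantMeasures (ι f)
    obtain ⟨ν, ⟨hν, hfν⟩, hne⟩ : ∃ ν, D.IsMaximizing (ι f) ν ∧ ν ≠ μ := by
      by_contra! h
      exact hf ⟨μ, ⟨hμ, hfμ⟩, h⟩
    obtain ⟨n, hn⟩ := exists_integral_ne_of_ne hw hne
    refine mem_iUnion.2 ⟨n, ?_⟩
    rcases hn.lt_or_gt with h | h
    · exact mem_kinkSet_of_integral_lt hν hμ hfν hfμ h
    · exact mem_kinkSet_of_integral_lt hμ hν hfμ hfν h
  · simpa only [mem_preimage, map_add, map_smul] using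
      volume_line_inter_kinkSet hD (ι v) (ι (w n))
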